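/- Let $R$ be a commutative ring with unity, and write $(-)^C=\operatorname{Hom}_R(-,C)$. Let $C$ be a semidualizing $R$-module, that is: $C$ has a resolution $\cdots\to P_1\to P_0\to C\to 0$ by finitely generated projective modules, the homothety map $R\to\operatorname{Hom}_R(C,C)$ is an isomorphism, and $\operatorname{Ext}^i_R(C,C)=0$ for all $i\ge 1$. An $R$-module $M$ is called $G_C$-projective if there is an exact sequence $$\mathbb X=\cdots\to P_1\to P_0\to C\otimes_R P_{-1}\to C\otimes_R P_{-2}\to\cdots$$ with all $P_i$ projective such that $M\cong\operatorname{im}(P_0\to C\otimes_R P_{-1})$ and $\operatorname{Hom}_R(\mathbb X,C\otimes_R P)$ is exact for every projective $R$-module $P$. Suppose that every finitely generated submodule of a $G_C$-projective $R$-module is $G_C$-projective. Then $R$ is coherent, i.e. every finitely generated ideal of $R$ is finitely presented. Moreover, for every finitely generated ideal $M$ of $R$ the natural map $M\to M^{CC}$ is an isomorphism, and $M^{CC}$ belongs to $\operatorname{gen}^*(R)$, i.e. there is an exact sequence $\cdots\to T_1\to T_0\to M^{CC}\to 0$ with each $T_i$ a direct summand of a finite direct sum of copies of $R$ which remains exact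 under $\operatorname{Hom}_R(R,-)$. -/

import Mathlib

open scoped TensorProduct

universe u

section HomologicalNotions

variable (R : Type u) [CommRing R]

/-- For linear maps `f : A → B` and `g : B → D`, the sequence
`Hom(D, N) → Hom(B, N) → Hom(A, N)` is exact at `Hom(B, N)`. -/
def ContraHomExact (N : Type u) [AddCommGroup N] [Module R N]
    {A B D : Type u} [AddCommGroup A] [Module R A] [AddCommGroup B] [Module R B]
    [AddCommGroup D] [Module R D] (f : A →ₗ[R] B) (g : B →ₗ[R] D) : Prop :=
  Function.Exact (fun φ : D →ₗ[R] N => φ ∘ₗ g) (fun φ : B →ₗ[R] N => φ ∘ₗ f)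

/-- For linear maps `f : A → B` and `g : B → D`, the sequence
`Hom(T, A) → Hom(T, B) → Hom(T, D)` is exact at `Hom(T, B)`. -/
def CoHomExact (T : Type u) [AddCommGroup T] [Module R T]
    {A B D : Type u} [AddCommGroup A] [Module R A] [AddCommGroup B] [Module R B]
    [AddCommGroup D] [Module R D] (f : A →ₗ[R] B) (g : B →ₗ[R] D) : Prop :=
  Function.Exact (fun φ : T →ₗ[R] A => f ∘ₗ φ) (fun φ : T →ₗ[R] B => g ∘ₗ φ)

/-- `M` has a resolution `⋯ → P₁ → P₀ → M → 0` by finitely generated projective modules. -/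
def HasDegreewiseFiniteProjectiveResolution
    (M : Type u) [AddCommGroup M] [Module R M] : Prop :=
  ∃ (P : ℕ → ModuleCat.{u} R) (d : ∀ n, P (n + 1) →ₗ[R] P n) (ε : P 0 →ₗ[R] M),
    (∀ n, Module.Finite R (P n) ∧ Module.Projective R (P n)) ∧
    Function.Surjective ε ∧
    Function.Exact (d 0) ε ∧
    ∀ n, Function.Exact (d (n + 1)) (d n)

/-- Semidualizing modules. -/
structure IsSemidualizing (C : Type u) [AddCommGroup C] [Module R C] : Prop where
  resolution : HasDegreewiseFiniteProjectiveResolution R C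
  homothety : Function.Bijective (LinearMap.lsmul R C : R →ₗ[R] C →ₗ[R] C)
  ext_eq_zero : ∀ i : ℕ, 1 ≤ i →
    Subsingleton (CategoryTheory.Abelian.Ext.{u} (ModuleCat.of R C) (ModuleCat.of R C) i)

/-- `M` is `G_C`-projective: there is an exact sequence
`X = ⋯ → P₁ → P₀ → C ⊗ Q₀ → C ⊗ Q₁ → ⋯` with all `Pₙ`, `Qₙ` projective
(`Qₙ` is the module usually written `P₋ₙ₋₁`), such that `M` is isomorphic to the image of
`P₀ → C ⊗ Q₀` and `Hom(X, C ⊗ L)` is exact for every projective module `L`. -/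
def IsGCProjective (C : Type u) [AddCommGroup C] [Module R C]
    (M : Type u) [AddCommGroup M] [Module R M] : Prop :=
  ∃ (P Q : ℕ → ModuleCat.{u} R)
    (d : ∀ n, P (n + 1) →ₗ[R] P n)
    (e : P 0 →ₗ[R] C ⊗[R] Q 0)
    (δ : ∀ n, C ⊗[R] Q n →ₗ[R] C ⊗[R] Q (n + 1)),
    (∀ n, Module.Projective R (P n)) ∧
    (∀ n, Module.Projective R (Q n)) ∧
    -- exactness of `X`
    ((∀ n, Function.Exact (d (n + 1)) (d n)) ∧
      Function.Exact (d 0) e ∧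
      Function.Exact e (δ 0) ∧
      (∀ n, Function.Exact (δ n) (δ (n + 1)))) ∧
    Nonempty (M ≃ₗ[R] LinearMap.range e) ∧
    -- exactness of `Hom(X, C ⊗ L)`
    ∀ (L : Type u) [AddCommGroup L] [Module R L], Module.Projective R L →
      (∀ n, ContraHomExact R (C ⊗[R] L) (d (n + 1)) (d n)) ∧
      ContraHomExact R (C ⊗[R] L) (d 0) e ∧
      ContraHomExact R (C ⊗[R] L) e (δ 0) ∧
      (∀ n, ContraHomExact R (C ⊗[R] L) (δ n) (δ (n + 1)))

/-- `M ∈ add T`: `M` is isomorphic to a direct summand of some `Tⁿ`, expressed by a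
split monomorphism `M → Tⁿ`. -/
def InAdd (T : Type u) [AddCommGroup T] [Module R T]
    (M : Type u) [AddCommGroup M] [Module R M] : Prop :=
  ∃ (n : ℕ) (i : M →ₗ[R] (Fin n → T)) (p : (Fin n → T) →ₗ[R] M), p ∘ₗ i = LinearMap.id

/-- `M ∈ gen*(T)`: there is an exact sequence `⋯ → T₁ → T₀ → M → 0` with all
`Tₙ ∈ add T` that stays exact under `Hom(T, -)`. -/
def InGenStar (T : Type u) [AddCommGroup T] [Module R T]
    (M : Type u) [AddCommGroup M] [Module R M] : Prop :=
  ∃ (X : ℕ → ModuleCat.{u} R) (d : ∀ n, X (n + 1) →ₗ[R] X n) (ε : X 0 →ₗ[R] M),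
    (∀ n, InAdd R T (X n)) ∧
    (Function.Surjective ε ∧
      Function.Exact (d 0) ε ∧
      ∀ n, Function.Exact (d (n + 1)) (d n)) ∧
    (Function.Surjective (fun φ : T →ₗ[R] X 0 => ε ∘ₗ φ) ∧
      CoHomExact R T (d 0) ε ∧
      ∀ n, CoHomExact R T (d (n + 1)) (d n))

/-- A commutative ring is coherent if its finitely generated ideals are finitely presented. -/
def IsCoherentRing : Prop :=
  ∀ I : Ideal R, I.FG → Module.FinitePresentation R I

/-- The biduality map `M → Hom(Hom(M, C), C)`, `m ↦ (φ ↦ φ m)`. -/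
def bidualityMap (C : Type u) [AddCommGroup C] [Module R C]
    (M : Type u) [AddCommGroup M] [Module R M] :
    M →ₗ[R] (M →ₗ[R] C) →ₗ[R] C :=
  (LinearMap.id : (M →ₗ[R] C) →ₗ[R] (M →ₗ[R] C)).flip

end HomologicalNotions

/-! Call `cogen C` the modules that embed into a finite power of `C`. As `C ⊗ Rⁿ ≃ Cⁿ` is
`G_C`-projective, the hypothesis makes every finitely generated `X ∈ cogen C` `G_C`-projective.
Truncating the coresolution of such an `X` gives an embedding `X → Cⁿ` through which all maps
`X → C` extend and whose cokernel `Z` is again in `cogen C`. Dualizing into `C` gives an exact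
sequence `Zᶜ → (Cⁿ)ᶜ ≃ Rⁿ → Xᶜ → 0`; here `Zᶜ` is finitely generated, by the same argument applied
to `Z`, so `Xᶜ` is finitely presented. Moreover `X` is `C`-reflexive, because `Cⁿ` is and the
biduality map of `Z` is injective. Now `Xᶜ` is itself a finitely generated module in `cogen C`, so
`X ≃ Xᶜᶜ` is finitely presented too. This applies to all finitely generated submodules of `Rⁿ`, as
`Rⁿ ≃ Hom(Cⁿ, C)` is in `cogen C`. -/

section ContraHomExact

variable {R : Type u} [CommRing R] {A B D N : Type u} [AddCommGroup A] [Module R A]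
  [AddCommGroup B] [Module R B] [AddCommGroup D] [Module R D] [AddCommGroup N] [Module R N]
  {f : A →ₗ[R] B} {g : B →ₗ[R] D}

lemma contraHomExact_of_comp_eq_zero (hgf : g ∘ₗ f = 0)
    (h : ∀ φ : B →ₗ[R] N, φ ∘ₗ f = 0 → ∃ ψ : D →ₗ[R] N, ψ ∘ₗ g = φ) :
    ContraHomExact R N f g := fun φ =>
  ⟨h φ, by rintro ⟨ψ, rfl⟩; exact (congrArg (ψ ∘ₗ ·) hgf).trans ψ.comp_zero⟩

lemma contraHomExact_of_surjective (hfg : Function.Exact f g) (hg : Function.Surjective g) :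
    ContraHomExact R N f g :=
  LinearMap.exact_lcomp_of_exact_of_surjective N hfg hg

lemma contraHomExact_of_forall_extends (hfg : Function.Exact f g)
    (h : ∀ φ : LinearMap.range g →ₗ[R] N, ∃ ψ : D →ₗ[R] N, ψ ∘ₗ (LinearMap.range g).subtype = φ) :
    ContraHomExact R N f g := by
  have hfg' : Function.Exact f g.rangeRestrict :=
    LinearMap.exact_iff.mpr ((LinearMap.ker_rangeRestrict g).trans hfg.linearMap_ker_eq)
  refine contraHomExact_of_comp_eq_zero hfg.linearMap_comp_eq_zero fun φ hφ => ?_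
  obtain ⟨χ, hχ⟩ :=
    (contraHomExact_of_surjective hfg' g.surjective_rangeRestrict φ).mp hφ
  obtain ⟨ψ, rfl⟩ := h χ
  exact ⟨ψ, hχ⟩

/- By adjunction `Hom(- ⊗ F, N)` is `Hom(F, Hom(-, N))`, and `Hom(F, -)` is exact. -/
lemma ContraHomExact.rTensor (h : ContraHomExact R N f g) (hgf : g ∘ₗ f = 0) (F : Type u)
    [AddCommGroup F] [Module R F] [Module.Projective R F] :
    ContraHomExact R N (f.rTensor F) (g.rTensor F) := by
  refine contraHomExact_of_comp_eq_zero
    (by rw [← LinearMap.rTensor_comp, hgf, LinearMap.rTensor_zero]) fun φ hφ => ?_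
  let φ' : F →ₗ[R] B →ₗ[R] N := (TensorProduct.curry φ).flip
  have hφ' (x : F) : φ' x ∈ LinearMap.range (g.lcomp R N) :=
    (h (φ' x)).mp (LinearMap.ext fun a => LinearMap.congr_fun hφ (a ⊗ₜ x))
  obtain ⟨χ, hχ⟩ := Module.projective_lifting_property (g.lcomp R N).rangeRestrict
    (φ'.codRestrict _ hφ') (g.lcomp R N).surjective_rangeRestrict
  refine ⟨TensorProduct.lift χ.flip, TensorProduct.ext' fun b x => ?_⟩
  exact LinearMap.congr_fun (congrArg Subtype.val (LinearMap.congr_fun hχ x)) b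

end ContraHomExact

section FiniteFactor

variable {R : Type u} [CommRing R]

lemma exists_finite_free_factor {Q : Type u} [AddCommGroup Q] [Module R Q]
    [Module.Projective R Q] {N : Submodule R Q} (hN : N.FG) :
    ∃ (n : ℕ) (v : Q →ₗ[R] (Fin n → R)) (w : (Fin n → R) →ₗ[R] Q), ∀ x ∈ N, w (v x) = x := by
  classical
  obtain ⟨s, hs⟩ := Module.projective_def'.mp ‹Module.Projective R Q›
  obtain ⟨t, rfl⟩ := hN
  let S : Finset Q := t.biUnion fun q => (s q).support
  have hS : Submodule.span R (t : Set Q) ≤ (Finsupp.supported R R (S : Set Q)).comap s :=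
    Submodule.span_le.mpr fun q hq =>
      Finset.coe_subset.mpr (Finset.subset_biUnion_of_mem (fun q => (s q).support) hq)
  let i := S.equivFin
  refine ⟨S.card, LinearMap.pi fun k => Finsupp.lapply (i.symm k : Q) ∘ₗ s,
    Fintype.linearCombination R (fun k => (i.symm k : Q)), fun x hx => ?_⟩
  calc ∑ k, s x (i.symm k) • (i.symm k : Q)
    _ = ∑ q ∈ S, s x q • q := by
      rw [← Finset.sum_coe_sort S, i.symm.sum_comp fun q : S => s x q • (q : Q)]
    _ = Finsupp.linearCombination R id (s x) :=
      (Finsupp.linearCombination_apply_of_mem_supported R (hS hx)).symm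
    _ = x := LinearMap.congr_fun hs x

variable {C : Type u} [AddCommGroup C] [Module R C]

lemma exists_finite_power_factor {Q : Type u} [AddCommGroup Q] [Module R Q]
    [Module.Projective R Q] {K : Submodule R (C ⊗[R] Q)} (hK : K.FG) :
    ∃ (n : ℕ) (v : C ⊗[R] Q →ₗ[R] (Fin n → C)) (w : (Fin n → C) →ₗ[R] C ⊗[R] Q),
      ∀ x ∈ K, w (v x) = x := by
  obtain ⟨t, rfl⟩ := hK
  obtain ⟨N, hN, ht⟩ :=
    TensorProduct.exists_finite_submodule_right_of_setFinite (t : Set (C ⊗[R] Q)) t.finite_toSet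
  obtain ⟨n, v, w, hvw⟩ := exists_finite_free_factor (Module.Finite.iff_fg.mp hN)
  have hvwN : w ∘ₗ v ∘ₗ N.subtype = N.subtype := LinearMap.ext fun x => hvw x x.2
  let e := TensorProduct.piScalarRight R R C (Fin n)
  refine ⟨n, e.toLinearMap ∘ₗ v.lTensor C, w.lTensor C ∘ₗ e.symm.toLinearMap, fun x hx => ?_⟩
  obtain ⟨z, rfl⟩ := Submodule.span_le.mpr ht hx
  simp only [LinearMap.comp_apply, LinearEquiv.coe_coe, LinearEquiv.symm_apply_apply]
  rw [← LinearMap.comp_apply, ← LinearMap.comp_apply, ← LinearMap.lTensor_comp,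
    ← LinearMap.lTensor_comp, LinearMap.comp_assoc, hvwN]

lemma ContraHomExact.tensor_of_finite {A B D : Type u} [AddCommGroup A] [Module R A]
    [AddCommGroup B] [Module R B] [AddCommGroup D] [Module R D] [Module.Finite R B]
    {f : A →ₗ[R] B} {g : B →ₗ[R] D} (h : ContraHomExact R C f g) (hgf : g ∘ₗ f = 0)
    (L : Type u) [AddCommGroup L] [Module R L] [Module.Projective R L] :
    ContraHomExact R (C ⊗[R] L) f g := by
  refine contraHomExact_of_comp_eq_zero hgf fun φ hφ => ?_
  obtain ⟨n, v, w, hvw⟩ := exists_finite_power_factor (Submodule.fg_range φ)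
  have hcoord (k : Fin n) : ∃ ψ : D →ₗ[R] C, ψ ∘ₗ g = LinearMap.proj k ∘ₗ v ∘ₗ φ :=
    (h _).mp <| by
      change (LinearMap.proj k ∘ₗ v ∘ₗ φ) ∘ₗ f = 0
      rw [LinearMap.comp_assoc, LinearMap.comp_assoc, hφ, LinearMap.comp_zero, LinearMap.comp_zero]
  choose ψ hψ using hcoord
  refine ⟨w ∘ₗ LinearMap.pi ψ, LinearMap.ext fun b => ?_⟩
  calc w (fun k => ψ k (g b))
    _ = w (v (φ b)) := congrArg w (funext fun k => LinearMap.congr_fun (hψ k) b)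
    _ = φ b := hvw _ ⟨b, rfl⟩

end FiniteFactor

section ExtVanishing

open CategoryTheory

variable {R : Type u} [CommRing R] {A P Z N : Type u} [AddCommGroup A] [Module R A]
  [AddCommGroup P] [Module R P] [AddCommGroup Z] [Module R Z] [AddCommGroup N] [Module R N]
  {f : A →ₗ[R] P} {g : P →ₗ[R] Z}

lemma subsingleton_ext_range [Module.Projective R P] (hfg : Function.Exact f g)
    (hg : Function.Surjective g) {i : ℕ}
    [Subsingleton (Abelian.Ext.{u} (ModuleCat.of R Z) (ModuleCat.of R N) (i + 2))] :
    Subsingleton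
      (Abelian.Ext.{u} (ModuleCat.of R (LinearMap.range f)) (ModuleCat.of R N) (i + 1)) := by
  rw [← hfg.linearMap_ker_eq]
  have : Projective (ModuleCat.of R P) := ModuleCat.projective_of_categoryTheory_projective _
  refine subsingleton_of_forall_eq 0 fun x => ?_
  obtain ⟨y, rfl⟩ := Abelian.Ext.contravariant_sequence_exact₁
    (LinearMap.shortExact_shortComplexKer hg) _ x (n₁ := i + 2) (by omega) (Subsingleton.elim _ _)
  rw [Abelian.Ext.eq_zero_of_projective (P := ModuleCat.of R P) y, Abelian.Ext.comp_zero]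

lemma exists_extends_of_subsingleton_ext_one (hfg : Function.Exact f g)
    (hg : Function.Surjective g)
    [Subsingleton (Abelian.Ext.{u} (ModuleCat.of R Z) (ModuleCat.of R N) 1)]
    (φ : LinearMap.range f →ₗ[R] N) : ∃ ψ : P →ₗ[R] N, ψ ∘ₗ (LinearMap.range f).subtype = φ := by
  revert φ
  rw [← hfg.linearMap_ker_eq]
  intro φ
  obtain ⟨y, hy⟩ := Abelian.Ext.contravariant_sequence_exact₁
    (LinearMap.shortExact_shortComplexKer hg) _ (Abelian.Ext.mk₀ (ModuleCat.ofHom φ)) rfl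
    (Subsingleton.elim _ _)
  obtain ⟨ψ, rfl⟩ := (Abelian.Ext.mk₀_bijective _ _).2 y
  rw [Abelian.Ext.mk₀_comp_mk₀] at hy
  exact ⟨ψ.hom, congrArg ModuleCat.Hom.hom ((Abelian.Ext.mk₀_bijective _ _).1 hy)⟩

/- Dimension shifting: `Ext¹(ZₙC, N) = Extⁿ⁺¹(C, N) = 0` for the syzygies `ZₙC` of `C`. -/
lemma contraHomExact_of_ext_eq_zero {C : Type u} [AddCommGroup C] [Module R C]
    {P : ℕ → ModuleCat.{u} R} [∀ n, Module.Projective R (P n)]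
    {d : ∀ n, P (n + 1) →ₗ[R] P n} {ε : P 0 →ₗ[R] C} (hε : Function.Surjective ε)
    (hdε : Function.Exact (d 0) ε) (hd : ∀ n, Function.Exact (d (n + 1)) (d n))
    (hC : ∀ i, 1 ≤ i →
      Subsingleton (Abelian.Ext.{u} (ModuleCat.of R C) (ModuleCat.of R N) i)) (n : ℕ) :
    ContraHomExact R N (d (n + 1)) (d n) := by
  have hd' (n : ℕ) : Function.Exact (d (n + 1)) (d n).rangeRestrict :=
    LinearMap.exact_iff.mpr ((LinearMap.ker_rangeRestrict _).trans (hd n).linearMap_ker_eq)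
  have hsyz (n i : ℕ) : Subsingleton
      (Abelian.Ext.{u} (ModuleCat.of R (LinearMap.range (d n))) (ModuleCat.of R N) (i + 1)) := by
    induction n generalizing i with
    | zero =>
      have := hC (i + 2) (by omega)
      exact subsingleton_ext_range hdε hε
    | succ n ih =>
      have := ih (i + 1)
      exact subsingleton_ext_range (hd' n) (d n).surjective_rangeRestrict
  refine contraHomExact_of_forall_extends (hd n) ?_
  cases n with
  | zero =>
    have := hC 1 le_rfl
    exact exists_extends_of_subsingleton_ext_one hdε hε
  | succ n =>
    have := hsyz n 0
    exact exists_extends_of_subsingleton_ext_one (hd' n) (d n).surjective_rangeRestrict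

end ExtVanishing

section GCProjective

variable {R : Type u} [CommRing R] {C : Type u} [AddCommGroup C] [Module R C]

lemma IsSemidualizing.finite (hC : IsSemidualizing R C) : Module.Finite R C := by
  obtain ⟨P, d, ε, hP, hε, -⟩ := hC.resolution
  have := (hP 0).1
  exact .of_surjective ε hε

lemma IsGCProjective.of_equiv {X Y : Type u} [AddCommGroup X] [Module R X] [AddCommGroup Y]
    [Module R Y] (hX : IsGCProjective R C X) (e : X ≃ₗ[R] Y) : IsGCProjective R C Y := by
  obtain ⟨P, Q, d, ε, δ, hP, hQ, hX, ⟨i⟩, hL⟩ := hX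
  exact ⟨P, Q, d, ε, δ, hP, hQ, hX, ⟨e.symm ≪≫ₗ i⟩, hL⟩

lemma IsSemidualizing.isGCProjective_tensor (hC : IsSemidualizing R C) (F : Type u)
    [AddCommGroup F] [Module R F] [Module.Projective R F] : IsGCProjective R C (C ⊗[R] F) := by
  obtain ⟨P, d, ε, hP, hε, hdε, hd⟩ := hC.resolution
  have hfin (n : ℕ) := (hP n).1
  have hproj (n : ℕ) := (hP n).2
  let Q : ℕ → ModuleCat.{u} R := fun
    | 0 => ModuleCat.of R F
    | _ + 1 => ModuleCat.of R PUnit.{u + 1}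
  let e : P 0 ⊗[R] F →ₗ[R] C ⊗[R] Q 0 := ε.rTensor F
  have he : Function.Surjective e := LinearMap.rTensor_surjective F hε
  have (n : ℕ) : Subsingleton (C ⊗[R] Q (n + 1)) :=
    inferInstanceAs (Subsingleton (C ⊗[R] PUnit.{u + 1}))
  have hde : Function.Exact ((d 0).rTensor F) e := Module.Flat.rTensor_exact F hdε
  have he0 : Function.Exact e (0 : C ⊗[R] Q 0 →ₗ[R] C ⊗[R] Q 1) := fun x =>
    ⟨fun _ => he x, fun _ => rfl⟩
  have h00 (n : ℕ) : Function.Exact (0 : C ⊗[R] Q n →ₗ[R] C ⊗[R] Q (n + 1))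
      (0 : C ⊗[R] Q (n + 1) →ₗ[R] C ⊗[R] Q (n + 2)) := fun x =>
    ⟨fun _ => ⟨0, Subsingleton.elim _ _⟩, fun _ => rfl⟩
  have hsurj0 (n : ℕ) : Function.Surjective (0 : C ⊗[R] Q n →ₗ[R] C ⊗[R] Q (n + 1)) :=
    fun x => ⟨0, Subsingleton.elim _ _⟩
  refine ⟨fun n => ModuleCat.of R (P n ⊗[R] F), Q, fun n => (d n).rTensor F, e, fun _ => 0,
    fun n => inferInstanceAs (Module.Projective R (P n ⊗[R] F)), ?_,
    ⟨fun n => Module.Flat.rTensor_exact F (hd n), hde, he0, h00⟩,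
    ⟨(LinearEquiv.ofTop _ (LinearMap.range_eq_top.mpr he)).symm⟩, fun L _ _ _ => ⟨fun n => ?_,
      contraHomExact_of_surjective hde he, contraHomExact_of_surjective he0 (hsurj0 0),
      fun n => contraHomExact_of_surjective (h00 n) (hsurj0 (n + 1))⟩⟩
  · rintro (_ | n)
    · exact inferInstanceAs (Module.Projective R F)
    · exact inferInstanceAs (Module.Projective R PUnit.{u + 1})
  · have hcomp := (hd n).linearMap_comp_eq_zero
    have hdC : ContraHomExact R C (d (n + 1)) (d n) :=
      contraHomExact_of_ext_eq_zero hε hdε hd hC.ext_eq_zero n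
    exact (hdC.tensor_of_finite hcomp L).rTensor hcomp F

lemma IsGCProjective.exists_tensor_embedding {X : Type u} [AddCommGroup X] [Module R X]
    (hX : IsGCProjective R C X) :
    ∃ (Q Q' : ModuleCat.{u} R) (j : X →ₗ[R] C ⊗[R] Q) (δ : C ⊗[R] Q →ₗ[R] C ⊗[R] Q'),
      Module.Projective R Q ∧ Module.Projective R Q' ∧ Function.Injective j ∧
      Function.Exact j δ ∧ Function.Surjective (j.lcomp R C) := by
  obtain ⟨P, Q, d, e, δ, -, hQ, ⟨-, hde, heδ, -⟩, ⟨i⟩, hL⟩ := hX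
  obtain ⟨-, hext, -⟩ := hL R inferInstance
  let j : X →ₗ[R] C ⊗[R] Q 0 := (LinearMap.range e).subtype ∘ₗ i.toLinearMap
  have hrange : LinearMap.range j = LinearMap.range e := by
    rw [LinearMap.range_comp, LinearEquiv.range, Submodule.map_top, Submodule.range_subtype]
  let p : P 0 →ₗ[R] X := i.symm.toLinearMap ∘ₗ e.rangeRestrict
  have hjp : j ∘ₗ p = e := by ext; simp [j, p]
  have hp : Function.Surjective p := i.symm.surjective.comp e.surjective_rangeRestrict
  have hdp : p ∘ₗ d 0 = 0 := by
    ext x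
    simp [p, show e.rangeRestrict (d 0 x) = 0 from Subtype.ext (hde.apply_apply_eq_zero x)]
  refine ⟨Q 0, Q 1, j, δ 0, hQ 0, hQ 1, Subtype.val_injective.comp i.injective,
    LinearMap.exact_iff.mpr (heδ.linearMap_ker_eq.trans hrange.symm), fun φ => ?_⟩
  let ρ := TensorProduct.rid R C
  obtain ⟨ψ, hψ⟩ := (hext (ρ.symm.toLinearMap ∘ₗ φ ∘ₗ p)).mp <| by
    change (ρ.symm.toLinearMap ∘ₗ φ ∘ₗ p) ∘ₗ d 0 = 0
    rw [LinearMap.comp_assoc, LinearMap.comp_assoc, hdp, LinearMap.comp_zero, LinearMap.comp_zero]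
  refine ⟨ρ.toLinearMap ∘ₗ ψ, LinearMap.ext fun x => ?_⟩
  obtain ⟨y, rfl⟩ := hp x
  have hy := LinearMap.congr_fun hψ y
  simp only [← hjp] at hy
  exact ρ.eq_symm_apply.mp hy

end GCProjective

section Cogen

variable (R : Type u) [CommRing R] (C : Type u) [AddCommGroup C] [Module R C]

/-- `M ∈ cogen C`: `M` embeds into a finite power of `C`. -/
def InCogen (M : Type u) [AddCommGroup M] [Module R M] : Prop :=
  ∃ (n : ℕ) (i : M →ₗ[R] (Fin n → C)), Function.Injective i

variable {R C} {M N : Type u} [AddCommGroup M] [Module R M] [AddCommGroup N] [Module R N]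

lemma InCogen.of_injective (hN : InCogen R C N) (f : M →ₗ[R] N) (hf : Function.Injective f) :
    InCogen R C M := by
  obtain ⟨n, i, hi⟩ := hN
  exact ⟨n, i ∘ₗ f, hi.comp hf⟩

variable (R C) in
lemma inCogen_prod_pow (m n : ℕ) : InCogen R C ((Fin m → C) × (Fin n → C)) :=
  let e := (LinearEquiv.sumArrowLequivProdArrow (Fin m) (Fin n) R C).symm ≪≫ₗ
    LinearEquiv.funCongrLeft R C finSumFinEquiv.symm
  ⟨m + n, e.toLinearMap, e.injective⟩

variable (R C M) in
lemma inCogen_hom [Module.Finite R M] : InCogen R C (M →ₗ[R] C) := by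
  obtain ⟨n, q, hq⟩ := Module.Finite.exists_fin' R M
  let e := LinearEquiv.piRing R C (Fin n) R
  exact ⟨n, e.toLinearMap ∘ₗ q.lcomp R C,
    e.injective.comp (LinearMap.lcomp_injective_of_surjective q hq)⟩

lemma InCogen.bidualityMap_injective (hM : InCogen R C M) :
    Function.Injective (bidualityMap R C M) := by
  obtain ⟨n, i, hi⟩ := hM
  intro x y hxy
  exact hi (funext fun k : Fin n =>
    LinearMap.congr_fun hxy ((LinearMap.proj k : (Fin n → C) →ₗ[R] C) ∘ₗ i))

end Cogen

section Duality

variable {R : Type u} [CommRing R] {C : Type u} [AddCommGroup C] [Module R C]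

/-- When `R → Hom(C, C)` is bijective, `Rⁿ ≃ Hom(Cⁿ, C)` via `r ↦ (c ↦ ∑ₖ rₖ cₖ)`. -/
noncomputable def homPowEquiv
    (hC : Function.Bijective (LinearMap.lsmul R C : R →ₗ[R] C →ₗ[R] C)) (n : ℕ) :
    (Fin n → R) ≃ₗ[R] ((Fin n → C) →ₗ[R] C) :=
  (LinearEquiv.piCongrRight fun _ => LinearEquiv.ofBijective _ hC) ≪≫ₗ
    LinearMap.lsum R (fun _ => C) R

lemma homPowEquiv_single (hC : Function.Bijective (LinearMap.lsmul R C : R →ₗ[R] C →ₗ[R] C))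
    {n : ℕ} (k : Fin n) : homPowEquiv hC n (Pi.single k 1) = LinearMap.proj k := by
  ext c
  simp [homPowEquiv, Pi.single_apply, eq_comm]

lemma bidualityMap_pow_bijective
    (hC : Function.Bijective (LinearMap.lsmul R C : R →ₗ[R] C →ₗ[R] C)) (n : ℕ) :
    Function.Bijective (bidualityMap R C (Fin n → C)) := by
  refine ⟨InCogen.bidualityMap_injective ⟨n, LinearMap.id, Function.injective_id⟩, fun Φ => ?_⟩
  let c : Fin n → C := fun k => Φ (LinearMap.proj k)
  have hc : bidualityMap R C _ c ∘ₗ (homPowEquiv hC n).toLinearMap =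
      Φ ∘ₗ (homPowEquiv hC n).toLinearMap := by
    ext k
    simp [homPowEquiv_single, bidualityMap, c]
  exact ⟨c, (LinearMap.cancel_right (homPowEquiv hC n).surjective).mp hc⟩

variable {M U : Type u} [AddCommGroup M] [Module R M] [AddCommGroup U] [Module R U]
  {a : M →ₗ[R] U}

lemma bidualityMap_bijective_of_extends (ha : Function.Injective a)
    (hext : Function.Surjective (a.lcomp R C)) (hU : Function.Bijective (bidualityMap R C U))
    (hZ : Function.Injective (bidualityMap R C (U ⧸ LinearMap.range a))) :
    Function.Bijective (bidualityMap R C M) := by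
  constructor
  · intro x y hxy
    exact ha (hU.1 (LinearMap.ext fun ψ => LinearMap.congr_fun hxy (ψ ∘ₗ a)))
  · intro Φ
    obtain ⟨u, hu⟩ := hU.2 (Φ ∘ₗ a.lcomp R C)
    have hψ (ψ : U →ₗ[R] C) : Φ (ψ ∘ₗ a) = ψ u := (LinearMap.congr_fun hu ψ).symm
    have hmem : u ∈ LinearMap.range a := by
      rw [← Submodule.Quotient.mk_eq_zero]
      refine hZ (LinearMap.ext fun χ => ?_)
      have hχ : (χ ∘ₗ (LinearMap.range a).mkQ) ∘ₗ a = 0 := by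
        rw [LinearMap.comp_assoc, LinearMap.range_mkQ_comp, LinearMap.comp_zero]
      calc χ (Submodule.Quotient.mk u)
        _ = Φ ((χ ∘ₗ (LinearMap.range a).mkQ) ∘ₗ a) := (hψ (χ ∘ₗ (LinearMap.range a).mkQ)).symm
        _ = bidualityMap R C _ 0 χ := by rw [hχ, map_zero, map_zero, LinearMap.zero_apply]
    obtain ⟨x, rfl⟩ := hmem
    refine ⟨x, LinearMap.ext fun φ => ?_⟩
    obtain ⟨ψ, rfl⟩ := hext φ
    exact (hψ ψ).symm

lemma finitePresentation_hom_of_extends (hext : Function.Surjective (a.lcomp R C))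
    [Module.FinitePresentation R (U →ₗ[R] C)]
    [Module.Finite R (U ⧸ LinearMap.range a →ₗ[R] C)] :
    Module.FinitePresentation R (M →ₗ[R] C) := by
  refine Module.finitePresentation_of_surjective _ hext ?_
  have hexact := LinearMap.exact_lcomp_of_exact_of_surjective C
    (LinearMap.exact_map_mkQ_range a) (Submodule.mkQ_surjective _)
  rw [hexact.linearMap_ker_eq]
  exact Submodule.fg_range _

end Duality

section Copresentation

variable {R : Type u} [CommRing R] {C : Type u} [AddCommGroup C] [Module R C]

lemma InCogen.quotient_range {M U Z : Type u} [AddCommGroup M] [Module R M] [AddCommGroup U]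
    [Module R U] [AddCommGroup Z] [Module R Z] {a : M →ₗ[R] U} {b : U →ₗ[R] Z}
    (hZ : InCogen R C Z) (hab : Function.Exact a b) : InCogen R C (U ⧸ LinearMap.range a) :=
  hZ.of_injective ((LinearMap.range a).liftQ b hab.linearMap_ker_eq.ge)
    (LinearMap.ker_eq_bot.mp (Submodule.ker_liftQ_eq_bot' _ _ hab.linearMap_ker_eq.symm))

/- Cut the embedding `X → C ⊗ Q` down to `Cⁿ` by a factorization `w ∘ v` that fixes `X`. An element
of `Cⁿ` comes from `X` iff it is fixed by `v ∘ w` and its image in `C ⊗ Q` is killed by `δ`. -/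
lemma IsGCProjective.exists_pow_embedding [Module.Finite R C] {X : Type u} [AddCommGroup X]
    [Module R X] [Module.Finite R X] (hX : IsGCProjective R C X) :
    ∃ (n : ℕ) (a : X →ₗ[R] (Fin n → C)), Function.Injective a ∧
      Function.Surjective (a.lcomp R C) ∧ InCogen R C ((Fin n → C) ⧸ LinearMap.range a) := by
  obtain ⟨Q, Q', j, δ, _, _, hj, hjδ, hext⟩ := hX.exists_tensor_embedding
  obtain ⟨n, v, w, hwv⟩ := exists_finite_power_factor (Submodule.fg_range j)
  obtain ⟨m, v', w', hwv'⟩ := exists_finite_power_factor (Submodule.fg_range (δ ∘ₗ w))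
  have hwvj (x : X) : w (v (j x)) = j x := hwv _ ⟨x, rfl⟩
  have hexact : Function.Exact (v ∘ₗ j) ((v' ∘ₗ δ ∘ₗ w).prod (LinearMap.id - v ∘ₗ w)) := by
    refine fun c => ⟨fun hc => ?_, ?_⟩
    · obtain ⟨hδ, hfix⟩ := Prod.ext_iff.mp hc
      have hδwc : δ (w c) = 0 := by
        calc δ (w c)
          _ = w' (v' (δ (w c))) := (hwv' _ ⟨c, rfl⟩).symm
          _ = 0 := (congrArg w' hδ).trans (map_zero w')
      obtain ⟨x, hx⟩ := (hjδ (w c)).mp hδwc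
      exact ⟨x, (congrArg v hx).trans (sub_eq_zero.mp hfix).symm⟩
    · rintro ⟨x, rfl⟩
      simp [hwvj, hjδ.apply_apply_eq_zero]
  refine ⟨n, v ∘ₗ j, fun x y hxy => hj ?_, fun φ => ?_,
    (inCogen_prod_pow R C m n).quotient_range hexact⟩
  · rw [← hwvj x, ← hwvj y]
    exact congrArg w hxy
  · obtain ⟨ψ, rfl⟩ := hext φ
    exact ⟨ψ ∘ₗ w, LinearMap.ext fun x => congrArg ψ (hwvj x)⟩

lemma IsSemidualizing.isGCProjective_of_inCogen (hC : IsSemidualizing R C)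
    (h : ∀ (G : Type u) [AddCommGroup G] [Module R G], IsGCProjective R C G →
      ∀ N : Submodule R G, N.FG → IsGCProjective R C N)
    (X : Type u) [AddCommGroup X] [Module R X] [Module.Finite R X] (hX : InCogen R C X) :
    IsGCProjective R C X := by
  obtain ⟨n, i, hi⟩ := hX
  let e := TensorProduct.piScalarRight R R C (Fin n)
  let i' : X →ₗ[R] C ⊗[R] (Fin n → R) := e.symm.toLinearMap ∘ₗ i
  have hi' : Function.Injective i' := e.symm.injective.comp hi
  exact (h _ (hC.isGCProjective_tensor _) _ (Submodule.fg_range i')).of_equiv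
    (LinearEquiv.ofInjective i' hi').symm

variable (hC : Function.Bijective (LinearMap.lsmul R C : R →ₗ[R] C →ₗ[R] C))
include hC

lemma inCogen_pow_self [Module.Finite R C] (n : ℕ) : InCogen R C (Fin n → R) :=
  (inCogen_hom R C _).of_injective (homPowEquiv hC n).toLinearMap (homPowEquiv hC n).injective

variable [Module.Finite R C] {X : Type u} [AddCommGroup X] [Module R X] [Module.Finite R X]

lemma IsGCProjective.bidualityMap_bijective (hX : IsGCProjective R C X) :
    Function.Bijective (bidualityMap R C X) := by
  obtain ⟨n, a, ha, hext, hZ⟩ := hX.exists_pow_embedding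
  exact bidualityMap_bijective_of_extends ha hext (bidualityMap_pow_bijective hC n)
    hZ.bidualityMap_injective

lemma IsGCProjective.finite_hom (hX : IsGCProjective R C X) : Module.Finite R (X →ₗ[R] C) := by
  obtain ⟨n, a, -, hext, -⟩ := hX.exists_pow_embedding
  exact .of_surjective (a.lcomp R C ∘ₗ (homPowEquiv hC n).toLinearMap)
    (hext.comp (homPowEquiv hC n).surjective)

variable (H : ∀ (Y : Type u) [AddCommGroup Y] [Module R Y] [Module.Finite R Y],
  InCogen R C Y → IsGCProjective R C Y)
include H

lemma InCogen.finitePresentation_hom (hX : InCogen R C X) :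
    Module.FinitePresentation R (X →ₗ[R] C) := by
  obtain ⟨n, a, -, hext, hZ⟩ := (H X hX).exists_pow_embedding
  have : Module.FinitePresentation R ((Fin n → C) →ₗ[R] C) := .of_equiv (homPowEquiv hC n)
  have := (H _ hZ).finite_hom hC
  exact finitePresentation_hom_of_extends hext

lemma InCogen.finitePresentation (hX : InCogen R C X) : Module.FinitePresentation R X := by
  have := (H X hX).finite_hom hC
  have : Module.FinitePresentation R ((X →ₗ[R] C) →ₗ[R] C) :=
    (inCogen_hom R C X).finitePresentation_hom hC H
  exact .of_equiv (LinearEquiv.ofBijective _ ((H X hX).bidualityMap_bijective hC)).symm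

end Copresentation

section GenStar

variable {R : Type u} [CommRing R]

lemma coHomExact_of_projective {T A B D : Type u} [AddCommGroup T] [Module R T]
    [Module.Projective R T] [AddCommGroup A] [Module R A] [AddCommGroup B] [Module R B]
    [AddCommGroup D] [Module R D] {f : A →ₗ[R] B} {g : B →ₗ[R] D} (hfg : Function.Exact f g) :
    CoHomExact R T f g := by
  refine fun φ => ⟨fun hφ => ?_, ?_⟩
  · obtain ⟨ψ, hψ⟩ := Module.projective_lifting_property f.rangeRestrict
      (φ.codRestrict _ fun x => (hfg (φ x)).mp (LinearMap.congr_fun hφ x))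
      f.surjective_rangeRestrict
    exact ⟨ψ, LinearMap.ext fun x => congrArg Subtype.val (LinearMap.congr_fun hψ x)⟩
  · rintro ⟨ψ, rfl⟩
    exact LinearMap.ext fun x => hfg.apply_apply_eq_zero (ψ x)

lemma inGenStar_self_of_free_resolution {M : Type u} [AddCommGroup M] [Module R M]
    {k : ℕ → ℕ} {d : ∀ n, (Fin (k (n + 1)) → R) →ₗ[R] (Fin (k n) → R)}
    {ε : (Fin (k 0) → R) →ₗ[R] M} (hε : Function.Surjective ε) (hdε : Function.Exact (d 0) ε)
    (hd : ∀ n, Function.Exact (d (n + 1)) (d n)) : InGenStar R R M :=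
  ⟨fun n => ModuleCat.of R (Fin (k n) → R), d, ε,
    fun n => ⟨k n, LinearMap.id, LinearMap.id, rfl⟩, ⟨hε, hdε, hd⟩,
    fun φ => Module.projective_lifting_property ε φ hε,
    coHomExact_of_projective hdε, fun n => coHomExact_of_projective (hd n)⟩

lemma exists_range_eq_and_fg_ker {M : Type u} [AddCommGroup M] [Module R M] (K : Submodule R M)
    [Module.FinitePresentation R K] :
    ∃ (m : ℕ) (f : (Fin m → R) →ₗ[R] M), LinearMap.range f = K ∧ (LinearMap.ker f).FG := by
  obtain ⟨m, f, hf⟩ := Module.Finite.exists_fin' R K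
  refine ⟨m, K.subtype ∘ₗ f, ?_, ?_⟩
  · rw [LinearMap.range_comp, LinearMap.range_eq_top.mpr hf, Submodule.map_top,
      Submodule.range_subtype]
  · rw [LinearMap.ker_comp, Submodule.ker_subtype]
    exact Module.FinitePresentation.fg_ker f hf

lemma inGenStar_self
    (h : ∀ (n : ℕ) (K : Submodule R (Fin n → R)), K.FG → Module.FinitePresentation R K)
    (M : Type u) [AddCommGroup M] [Module R M] [Module.FinitePresentation R M] :
    InGenStar R R M := by
  obtain ⟨k₀, ε, hε⟩ := Module.Finite.exists_fin' R M
  have hker := Module.FinitePresentation.fg_ker ε hε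
  choose! m f hf hf_ker using fun (n : ℕ) (K : Submodule R (Fin n → R)) (hK : K.FG) =>
    have := h n K hK
    exists_range_eq_and_fg_ker K
  let K : ℕ → Σ n : ℕ, {K : Submodule R (Fin n → R) // K.FG} := fun n =>
    n.rec ⟨k₀, LinearMap.ker ε, hker⟩
      fun _ K => ⟨m K.1 K.2.1, LinearMap.ker (f K.1 K.2.1), hf_ker _ _ K.2.2⟩
  exact inGenStar_self_of_free_resolution (k := fun n => (K n).1)
    (d := fun n => f (K n).1 (K n).2.1) hε (LinearMap.exact_iff.mpr (hf _ _ hker).symm)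
    fun n => LinearMap.exact_iff.mpr (hf _ _ (K (n + 1)).2.2).symm

end GenStar

theorem theorem3p2 (R : Type u) [CommRing R] (C : Type u) [AddCommGroup C] [Module R C]
    (hC : IsSemidualizing R C)
    (h : ∀ (G : Type u) [AddCommGroup G] [Module R G], IsGCProjective R C G →
      ∀ N : Submodule R G, N.FG → IsGCProjective R C N) :
    IsCoherentRing R ∧
      ∀ M : Ideal R, M.FG →
        Function.Bijective (bidualityMap R C M) ∧
        InGenStar R R ((M →ₗ[R] C) →ₗ[R] C) := by
  have := hC.finite
  have H := hC.isGCProjective_of_inCogen h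
  have hpow (n : ℕ) (K : Submodule R (Fin n → R)) (hK : K.FG) : Module.FinitePresentation R K := by
    have := Module.Finite.iff_fg.mpr hK
    exact ((inCogen_pow_self hC.homothety n).of_injective K.subtype
      K.subtype_injective).finitePresentation hC.homothety H
  have hideal (M : Ideal R) : InCogen R C M :=
    (inCogen_hom R C C).of_injective (LinearMap.lsmul R C ∘ₗ M.subtype)
      (hC.homothety.1.comp M.subtype_injective)
  have hcoh : IsCoherentRing R := fun M hM =>
    have := Module.Finite.iff_fg.mpr hM
    (hideal M).finitePresentation hC.homothety H
  refine ⟨hcoh, fun M hM => ?_⟩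
  have := hcoh M hM
  have hbi := (H M (hideal M)).bidualityMap_bijective hC.homothety
  have : Module.FinitePresentation R ((M →ₗ[R] C) →ₗ[R] C) := .of_equiv (.ofBijective _ hbi)
  exact ⟨hbi, inGenStar_self hpow _⟩
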